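/- Let $\mathbf k$ be an algebraically closed field and let $\mathcal C$ be a finite tensor category over $\mathbf k$: a $\mathbf k$-linear abelian rigid monoidal category with biadditive tensor product, in which the unit object $\mathbf 1$ is simple, all $\mathrm{Hom}$-spaces are finite dimensional over $\mathbf k$, every object has finite length, there are finitely many isomorphism classes of simple objects, and every simple object has a projective cover. Let $X_0,\dots,X_{n-1}$ be representatives of the isomorphism classes of simple objects, and let $[Y:X_j]$ denote the multiplicity of $X_j$ in a composition series of an object $Y$. Let $\mathrm{Gr}(\mathcal C)$ be the Grothendieck ring of $\mathcal C$, i.e. the free abelian group on the isomorphism classes of simple objects with multiplication $X_i\cdot X_j=\sum_l [X_i\otimes X_j:X_l]\,X_l$; an object $Y$ defines the element $[Y]=\sum_j [Y:X_j]\,X_j$. For an object $X$ let $N_X$ be the matrix with entries $(N_X)_{ij}=[X\otimes X_i:X_j]$, and let the Frobenius–Perron dimension $d_+(X)\in\mathbb R_{\ge 0}$ be the spectral radius of $N_X$. Then: 1. There is a (unital) ring homomorphism $d_+:\mathrm{Gr}(\mathcal C)\to\mathbb R$ with $d_+([X])=d_+(X)$ for every object $X$ of $\mathcal C$. 2. $d_+(X)>0$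 for every simple object $X$. 3. $d_+$ is the unique ring homomorphism $\chi:\mathrm{Gr}(\mathcal C)\to\mathbb R$ such that $\chi(X_i)>0$ for $i=0,\dots,n-1$. -/

import Mathlib

open CategoryTheory CategoryTheory.Limits CategoryTheory.MonoidalCategory ZeroObject

namespace FusionRing

universe v u w

section Simples

variable (C : Type u) [Category.{v} C] [Abelian C]

/-- Two simple objects are equivalent when they are isomorphic. -/
def simpleSetoid : Setoid {X : C // Simple X} where
  r X Y := Nonempty (X.1 ≅ Y.1)
  iseqv := ⟨fun _ => ⟨Iso.refl _⟩, fun ⟨e⟩ => ⟨e.symm⟩, fun ⟨e⟩ ⟨f⟩ => ⟨e.trans f⟩⟩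

/-- The set of isomorphism classes of simple objects of `C`. -/
def SimpleClass : Type u := Quotient (simpleSetoid C)

variable {C}

/-- The isomorphism class of a simple object. -/
def simpleClass (X : C) [h : Simple X] : SimpleClass C := Quotient.mk (simpleSetoid C) ⟨X, h⟩

theorem simpleClass_eq_iff (X Y : C) [Simple X] [Simple Y] :
    simpleClass X = simpleClass Y ↔ Nonempty (X ≅ Y) :=
  Quotient.eq (r := simpleSetoid C)

/-- A chosen simple object in an isomorphism class. -/
noncomputable def SimpleClass.obj (s : SimpleClass C) : C := (Quotient.out s).1

instance SimpleClass.simple_obj (s : SimpleClass C) : Simple s.obj := (Quotient.out s).2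

@[simp] theorem simpleClass_obj (s : SimpleClass C) : simpleClass s.obj = s :=
  Quotient.out_eq s

/-- `HasCompositionFactors X m` : the object `X` has a composition series (a finite filtration with
simple successive quotients) whose multiset of isomorphism classes of successive quotients is
`m`. -/
inductive HasCompositionFactors : C → Multiset (SimpleClass C) → Prop
  | zero {X : C} (h : IsZero X) : HasCompositionFactors X 0
  | step {A X S : C} (f : A ⟶ X) (g : X ⟶ S) (w : f ≫ g = 0)
      (h : (ShortComplex.mk f g w).ShortExact) [Simple S] {m : Multiset (SimpleClass C)}
      (hA : HasCompositionFactors A m) : HasCompositionFactors X (simpleClass S ::ₘ m)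

theorem shortExact_kernel {X S : C} (g : X ⟶ S) [Epi g] :
    (ShortComplex.mk (kernel.ι g) g (kernel.condition g)).ShortExact :=
  ShortComplex.ShortExact.mk' (ShortComplex.exact_kernel g) inferInstance inferInstance

theorem HasCompositionFactors.of_iso {X Y : C} (e : X ≅ Y) {m : Multiset (SimpleClass C)}
    (h : HasCompositionFactors X m) : HasCompositionFactors Y m := by
  cases h with
  | zero h => exact .zero (h.of_iso e.symm)
  | @step A _ S f g w h _ m hA =>
    refine .step (f ≫ e.hom) (e.inv ≫ g) (by simp [w]) ?_ hA
    exact ShortComplex.shortExact_of_iso (S₁ := ShortComplex.mk f g w)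
      (ShortComplex.isoMk (Iso.refl A) e (Iso.refl S) (by simp) (by simp)) h

/-- Exchange step for the Jordan–Hölder theorem. -/
theorem HasCompositionFactors.exchange {X : C} {m : Multiset (SimpleClass C)}
    (hX : HasCompositionFactors X m) :
    ∀ {B T : C} [Simple T] (b : B ⟶ X) (h : X ⟶ T) (w : b ≫ h = 0)
      (_ : (ShortComplex.mk b h w).ShortExact),
      ∃ n, HasCompositionFactors B n ∧ m = simpleClass T ::ₘ n := by
  induction hX with
  | zero hz =>
    intro B T _ b h w hs
    have := hs.epi_g
    exact absurd (IsZero.of_epi (f := h) hz) (Simple.not_isZero T)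
  | @step A X S f g w hfg _ m hA ih =>
    intro B T _ b h w' hs
    have hg : Epi g := hfg.epi_g
    have hf : Mono f := hfg.mono_f
    have hh : Epi h := hs.epi_g
    have hb : Mono b := hs.mono_f
    by_cases hc : f ≫ h = 0
    · let t : S ⟶ T := hfg.gIsCokernel.desc (CokernelCofork.ofπ h hc)
      have ht : g ≫ t = h := hfg.gIsCokernel.fac (CokernelCofork.ofπ h hc) WalkingParallelPair.one
      have ht0 : t ≠ 0 := by
        rintro h0
        rw [h0, comp_zero] at ht
        have : IsZero T := IsZero.of_epi_eq_zero h ht.symm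
        exact Simple.not_isZero T this
      have : IsIso t := isIso_of_hom_simple ht0
      have hbg : b ≫ g = 0 := by
        rw [← cancel_mono t, Category.assoc, ht, w', zero_comp]
      let p : A ⟶ B := hs.fIsKernel.lift (KernelFork.ofι f hc)
      have hp : p ≫ b = f := hs.fIsKernel.fac (KernelFork.ofι f hc) WalkingParallelPair.zero
      let q : B ⟶ A := hfg.fIsKernel.lift (KernelFork.ofι b hbg)
      have hq : q ≫ f = b := hfg.fIsKernel.fac (KernelFork.ofι b hbg) WalkingParallelPair.zero
      let e : A ≅ B := ⟨p, q, by rw [← cancel_mono f]; simp [hq, hp],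
        by rw [← cancel_mono b]; simp [hq, hp]⟩
      refine ⟨m, hA.of_iso e, ?_⟩
      rw [(simpleClass_eq_iff S T).2 ⟨asIso t⟩]
    · have hepi : Epi (f ≫ h) := epi_of_nonzero_to_simple hc
      obtain ⟨n, hn, rfl⟩ := ih (kernel.ι (f ≫ h)) (f ≫ h) (kernel.condition _)
        (shortExact_kernel _)
      let d := kernel.ι (f ≫ h)
      have hd : (d ≫ f) ≫ h = 0 := by simp [d, kernel.condition]
      let j : kernel (f ≫ h) ⟶ B := hs.fIsKernel.lift (KernelFork.ofι (d ≫ f) hd)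
      have hj : j ≫ b = d ≫ f :=
        hs.fIsKernel.fac (KernelFork.ofι (d ≫ f) hd) WalkingParallelPair.zero
      have hjmono : Mono j := by
        have : Mono (j ≫ b) := by rw [hj]; infer_instance
        exact mono_of_mono j b
      have hbg : b ≫ g ≠ 0 := by
        intro h0
        let t : T ⟶ S := hs.gIsCokernel.desc (CokernelCofork.ofπ g h0)
        have ht : h ≫ t = g := hs.gIsCokernel.fac (CokernelCofork.ofπ g h0) WalkingParallelPair.one
        have ht0 : t ≠ 0 := by
          rintro h1
          rw [h1, comp_zero] at ht
          exact Simple.not_isZero S (IsZero.of_epi_eq_zero g ht.symm)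
        have : IsIso t := isIso_of_hom_simple ht0
        apply hc
        rw [← cancel_mono t, Category.assoc, ht, w, zero_comp]
      have hepi' : Epi (b ≫ g) := epi_of_nonzero_to_simple hbg
      have hjg : j ≫ b ≫ g = 0 := by rw [← Category.assoc, hj, Category.assoc, w, comp_zero]
      have hse : (ShortComplex.mk j (b ≫ g) hjg).ShortExact := by
        refine ShortComplex.ShortExact.mk' ?_ hjmono hepi'
        refine ShortComplex.exact_of_f_is_kernel _ ?_
        refine KernelFork.IsLimit.ofι' j hjg ?_
        intro Z k hk
        have hk' : (k ≫ b) ≫ g = 0 := by simpa using hk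
        let l : Z ⟶ A := hfg.fIsKernel.lift (KernelFork.ofι (k ≫ b) hk')
        have hl : l ≫ f = k ≫ b :=
          hfg.fIsKernel.fac (KernelFork.ofι (k ≫ b) hk') WalkingParallelPair.zero
        have hl' : l ≫ f ≫ h = 0 := by
          rw [← Category.assoc, hl, Category.assoc, w', comp_zero]
        refine ⟨kernel.lift (f ≫ h) l hl', ?_⟩
        rw [← cancel_mono b, Category.assoc, hj, ← Category.assoc]
        simp [d, hl]
      exact ⟨simpleClass S ::ₘ n, .step j (b ≫ g) hjg hse hn, Multiset.cons_swap _ _ _⟩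

/-- The Jordan–Hölder theorem. -/
theorem HasCompositionFactors.unique {X : C} {m m' : Multiset (SimpleClass C)}
    (h : HasCompositionFactors X m) (h' : HasCompositionFactors X m') : m = m' := by
  induction h' generalizing m with
  | zero hz =>
    cases h with
    | zero => rfl
    | @step A _ S f g w h _ m hA =>
      have := h.epi_g
      exact absurd (IsZero.of_epi (f := g) hz) (Simple.not_isZero S)
  | step f g w hs hA ih =>
    obtain ⟨n, hn, rfl⟩ := h.exchange f g w hs
    rw [ih hn]

/-- Composition factors add up in short exact sequences. -/
theorem HasCompositionFactors.add {B : C} {n : Multiset (SimpleClass C)}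
    (hB : HasCompositionFactors B n) :
    ∀ {A X : C} {m : Multiset (SimpleClass C)} (f : A ⟶ X) (g : X ⟶ B) (w : f ≫ g = 0)
      (_ : (ShortComplex.mk f g w).ShortExact) (_ : HasCompositionFactors A m),
      HasCompositionFactors X (m + n) := by
  induction hB with
  | zero hz =>
    intro A X m f g w hs hA
    have : IsIso f := hs.isIso_f_iff.2 hz
    rw [add_zero]
    exact hA.of_iso (asIso f)
  | @step B' B S f' g' w' hs' _ n hB' ih =>
    intro A X m f g w hs hA
    have hg : Epi g := hs.epi_g
    have hg' : Epi g' := hs'.epi_g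
    have hf : Mono f := hs.mono_f
    have hf' : Mono f' := hs'.mono_f
    rw [Multiset.add_cons]
    refine .step (pullback.fst g f') (g ≫ g') ?_ ?_ (ih (A := A)
      (pullback.lift f 0 (by simp [w])) (pullback.snd g f') (pullback.lift_snd _ _ _) ?_ hA)
    · rw [← Category.assoc, pullback.condition, Category.assoc, w', comp_zero]
    · refine ShortComplex.ShortExact.mk' ?_ (by dsimp; infer_instance) (by dsimp; infer_instance)
      refine ShortComplex.exact_of_f_is_kernel _ ?_
      refine KernelFork.IsLimit.ofι' _ _ ?_
      intro Z k hk
      have hk' : (k ≫ g) ≫ g' = 0 := by simpa using hk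
      let l : Z ⟶ B' := hs'.fIsKernel.lift (KernelFork.ofι (k ≫ g) hk')
      have hl : l ≫ f' = k ≫ g :=
        hs'.fIsKernel.fac (KernelFork.ofι (k ≫ g) hk') WalkingParallelPair.zero
      exact ⟨pullback.lift k l hl.symm, pullback.lift_fst _ _ _⟩
    · have hmono : Mono (pullback.lift (f := g) (g := f') f (0 : A ⟶ B') (by simp [w])) := by
        have : Mono (pullback.lift (f := g) (g := f') f (0 : A ⟶ B') (by simp [w]) ≫
            pullback.fst g f') := by rw [pullback.lift_fst]; exact hf
        exact mono_of_mono _ (pullback.fst g f')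
      refine ShortComplex.ShortExact.mk' ?_ hmono (by dsimp; infer_instance)
      refine ShortComplex.exact_of_f_is_kernel _ ?_
      refine KernelFork.IsLimit.ofι' _ _ ?_
      intro Z k hk
      have hk0 : k ≫ pullback.snd g f' = 0 := hk
      have hk' : (k ≫ pullback.fst g f') ≫ g = 0 := by
        rw [Category.assoc, pullback.condition, ← Category.assoc, hk0, zero_comp]
      let l : Z ⟶ A := hs.fIsKernel.lift (KernelFork.ofι (k ≫ pullback.fst g f') hk')
      have hl : l ≫ f = k ≫ pullback.fst g f' :=
        hs.fIsKernel.fac (KernelFork.ofι (k ≫ pullback.fst g f') hk') WalkingParallelPair.zero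
      refine ⟨l, pullback.hom_ext ?_ ?_⟩
      · rw [Category.assoc, pullback.lift_fst, hl]
      · rw [Category.assoc, pullback.lift_snd, hk0, comp_zero]

theorem HasCompositionFactors.simple (S : C) [Simple S] :
    HasCompositionFactors S {simpleClass S} :=
  .step (A := 0) 0 (𝟙 S) (by simp) (ShortComplex.ShortExact.mk'
    ((ShortComplex.exact_iff_mono _ rfl).2 (by dsimp; infer_instance))
    (by dsimp; infer_instance) (by dsimp; infer_instance)) (.zero (isZero_zero C))

variable (C) in
/-- All objects of the abelian category `C` have finite length. -/
class FiniteLengthCategory : Prop where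
  exists_factors : ∀ X : C, ∃ m, HasCompositionFactors X m

variable [FiniteLengthCategory C]

/-- The multiset of composition factors of an object. -/
noncomputable def compositionFactors (X : C) : Multiset (SimpleClass C) :=
  (FiniteLengthCategory.exists_factors X).choose

theorem hasCompositionFactors (X : C) : HasCompositionFactors X (compositionFactors X) :=
  (FiniteLengthCategory.exists_factors X).choose_spec

theorem compositionFactors_eq {X : C} {m : Multiset (SimpleClass C)}
    (h : HasCompositionFactors X m) : compositionFactors X = m :=
  (hasCompositionFactors X).unique h

open Classical in
/-- The multiplicity `[X : s]` of (the class of) a simple object `s` in `X`. -/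
noncomputable def multiplicity (X : C) (s : SimpleClass C) : ℕ := (compositionFactors X).count s

end Simples

section Exactness

variable {C : Type u} [Category.{v} C] [Abelian C] [MonoidalCategory C] [MonoidalPreadditive C]

theorem isZero_tensor_left {X : C} (Y : C) (h : IsZero X) : IsZero (X ⊗ Y) :=
  (tensorRight Y).map_isZero h

theorem isZero_tensor_right {X : C} (Y : C) (h : IsZero X) : IsZero (Y ⊗ X) :=
  (tensorLeft Y).map_isZero h

variable [RigidCategory C]

theorem tensorLeft_shortExact (Y : C) {A X B : C} (f : A ⟶ X) (g : X ⟶ B) (w : f ≫ g = 0)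
    (h : (ShortComplex.mk f g w).ShortExact) :
    (ShortComplex.mk (Y ◁ f) (Y ◁ g) (by rw [← whiskerLeft_comp, w]; simp)).ShortExact := by
  have := (tensorLeftAdjunction Y (Yᘁ)).rightAdjoint_preservesLimits
  have := (tensorLeftAdjunction (ᘁY) Y).leftAdjoint_preservesColimits
  exact h.map_of_exact (tensorLeft Y)

theorem tensorRight_shortExact (Y : C) {A X B : C} (f : A ⟶ X) (g : X ⟶ B) (w : f ≫ g = 0)
    (h : (ShortComplex.mk f g w).ShortExact) :
    (ShortComplex.mk (f ▷ Y) (g ▷ Y) (by rw [← comp_whiskerRight, w]; simp)).ShortExact := by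
  have := (tensorRightAdjunction (ᘁY) Y).rightAdjoint_preservesLimits
  have := (tensorRightAdjunction Y (Yᘁ)).leftAdjoint_preservesColimits
  exact h.map_of_exact (tensorRight Y)

end Exactness

section GrothendieckRing

variable (C : Type u) [Category.{v} C] [Abelian C]

/-- The Grothendieck group: the free abelian group on the isomorphism classes of simple
objects. -/
def Gr : Type u := SimpleClass C →₀ ℤ

noncomputable instance : AddCommGroup (Gr C) := inferInstanceAs (AddCommGroup (SimpleClass C →₀ ℤ))

variable {C}

/-- The basis element of the Grothendieck group given by a class of simple objects. -/
noncomputable def Gr.of (s : SimpleClass C) : Gr C := Finsupp.single s (1 : ℤ)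

variable (C) in
/-- The classes of simple objects form a `ℤ`-basis of the Grothendieck group. -/
noncomputable def Gr.basis : Module.Basis (SimpleClass C) ℤ (Gr C) :=
  Module.Basis.ofRepr (LinearEquiv.refl ℤ (SimpleClass C →₀ ℤ))

theorem Gr.basis_apply (s : SimpleClass C) : Gr.basis C s = Gr.of s := rfl

variable [FiniteLengthCategory C]

/-- The class `∑ₛ [X : s] s` of an object in the Grothendieck group. -/
noncomputable def Gr.cls (X : C) : Gr C := ((compositionFactors X).map Gr.of).sum

theorem Gr.basis_repr_cls (X : C) (s : SimpleClass C) :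
    (Gr.basis C).repr (Gr.cls X) s = (multiplicity X s : ℤ) := by
  classical
  unfold Gr.cls multiplicity
  induction compositionFactors X using Multiset.induction with
  | empty => simp
  | cons a m ih =>
    rw [Multiset.map_cons, Multiset.sum_cons, map_add, Finsupp.add_apply, ih,
      ← Gr.basis_apply, Module.Basis.repr_self, Multiset.count_cons, Finsupp.single_apply]
    push_cast
    simp only [eq_comm (a := a)]
    ring

theorem Gr.cls_of_shortExact {A X B : C} (f : A ⟶ X) (g : X ⟶ B) (w : f ≫ g = 0)
    (h : (ShortComplex.mk f g w).ShortExact) : Gr.cls X = Gr.cls A + Gr.cls B := by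
  unfold Gr.cls
  rw [compositionFactors_eq ((hasCompositionFactors B).add f g w h (hasCompositionFactors A)),
    Multiset.map_add, Multiset.sum_add]

theorem Gr.cls_of_iso {X Y : C} (e : X ≅ Y) : Gr.cls X = Gr.cls Y := by
  unfold Gr.cls
  rw [compositionFactors_eq ((hasCompositionFactors Y).of_iso e.symm)]

theorem Gr.cls_of_isZero {X : C} (h : IsZero X) : Gr.cls X = 0 := by
  unfold Gr.cls
  rw [compositionFactors_eq (.zero h)]
  simp

theorem Gr.cls_simple (S : C) [Simple S] : Gr.cls S = Gr.of (simpleClass S) := by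
  unfold Gr.cls
  rw [compositionFactors_eq (.simple S)]
  simp

theorem Gr.of_eq_cls (s : SimpleClass C) : Gr.of s = Gr.cls s.obj := by
  rw [Gr.cls_simple, simpleClass_obj]

theorem Gr.induction {P : Gr C → Prop} (h0 : P 0) (hadd : ∀ x y, P x → P y → P (x + y))
    (hneg : ∀ x, P x → P (-x)) (hof : ∀ X : C, P (Gr.cls X)) (x : Gr C) : P x := by
  have hx : x ∈ Submodule.span ℤ (Set.range (Gr.basis C)) := by
    rw [Module.Basis.span_eq]; trivial
  rw [← Submodule.mem_toAddSubgroup, Submodule.span_int_eq_addSubgroupClosure] at hx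
  induction hx using AddSubgroup.closure_induction with
  | mem x hx =>
    obtain ⟨s, rfl⟩ := hx
    rw [Gr.basis_apply, Gr.of_eq_cls]
    exact hof _
  | zero => exact h0
  | add x y _ _ hx hy => exact hadd x y hx hy
  | neg x _ hx => exact hneg x hx

/-- Two additive functions of objects agree if they agree on simple objects. -/
theorem additive_ext {M : Type*} [AddCommGroup M] (φ ψ : C → M)
    (hφ0 : ∀ X, IsZero X → φ X = 0) (hψ0 : ∀ X, IsZero X → ψ X = 0)
    (hφ : ∀ {A X B : C} (f : A ⟶ X) (g : X ⟶ B) (w : f ≫ g = 0),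
      (ShortComplex.mk f g w).ShortExact → φ X = φ A + φ B)
    (hψ : ∀ {A X B : C} (f : A ⟶ X) (g : X ⟶ B) (w : f ≫ g = 0),
      (ShortComplex.mk f g w).ShortExact → ψ X = ψ A + ψ B)
    (hs : ∀ S : C, Simple S → φ S = ψ S) (X : C) : φ X = ψ X := by
  have h := hasCompositionFactors X
  generalize compositionFactors X = m at h
  induction h with
  | zero h => rw [hφ0 _ h, hψ0 _ h]
  | @step A X S f g w h hS m hA ih => rw [hφ f g w h, hψ f g w h, ih, hs S hS]

variable [MonoidalCategory C]

/-- The multiplication of the Grothendieck ring, as a bilinear map; on basis elements it is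
`s · t = ∑ᵣ [s ⊗ t : r] r`. -/
noncomputable def Gr.mulMap : Gr C →ₗ[ℤ] Gr C →ₗ[ℤ] Gr C :=
  (Gr.basis C).constr ℤ fun s => (Gr.basis C).constr ℤ fun t => Gr.cls (s.obj ⊗ t.obj)

noncomputable instance : Mul (Gr C) := ⟨fun x y => Gr.mulMap x y⟩

noncomputable instance : One (Gr C) := ⟨Gr.cls (𝟙_ C)⟩

theorem Gr.mul_def (x y : Gr C) : x * y = Gr.mulMap x y := rfl

theorem Gr.of_mul_of (s t : SimpleClass C) : Gr.of s * Gr.of t = Gr.cls (s.obj ⊗ t.obj) := by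
  rw [Gr.mul_def, Gr.mulMap, ← Gr.basis_apply, ← Gr.basis_apply, Module.Basis.constr_basis,
    Module.Basis.constr_basis]

variable [MonoidalPreadditive C] [RigidCategory C]

theorem Gr.cls_mul_cls (X Y : C) : Gr.cls X * Gr.cls Y = Gr.cls (X ⊗ Y) := by
  refine additive_ext (fun X => Gr.cls X * Gr.cls Y) (fun X => Gr.cls (X ⊗ Y)) ?_ ?_ ?_ ?_ ?_ X
  · intro X h
    simp [Gr.mul_def, Gr.cls_of_isZero h]
  · intro X h
    exact Gr.cls_of_isZero (isZero_tensor_left Y h)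
  · intro A X B f g w h
    simp [Gr.mul_def, Gr.cls_of_shortExact f g w h]
  · intro A X B f g w h
    exact Gr.cls_of_shortExact _ _ _ (tensorRight_shortExact Y f g w h)
  · intro S hS
    refine additive_ext (fun Y => Gr.cls S * Gr.cls Y) (fun Y => Gr.cls (S ⊗ Y)) ?_ ?_ ?_ ?_ ?_ Y
    · intro X h
      simp [Gr.mul_def, Gr.cls_of_isZero h]
    · intro X h
      exact Gr.cls_of_isZero (isZero_tensor_right S h)
    · intro A X B f g w h
      simp [Gr.mul_def, Gr.cls_of_shortExact f g w h]
    · intro A X B f g w h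
      exact Gr.cls_of_shortExact _ _ _ (tensorLeft_shortExact S f g w h)
    · intro T hT
      obtain ⟨e⟩ := (simpleClass_eq_iff _ _).1 (simpleClass_obj (simpleClass S))
      obtain ⟨e'⟩ := (simpleClass_eq_iff _ _).1 (simpleClass_obj (simpleClass T))
      rw [Gr.cls_simple S, Gr.cls_simple T, Gr.of_mul_of]
      exact Gr.cls_of_iso (e ⊗ᵢ e')

theorem Gr.mul_assoc' (x y z : Gr C) : x * y * z = x * (y * z) := by
  induction x using Gr.induction with
  | h0 => simp [Gr.mul_def]
  | hadd a b ha hb => simp only [Gr.mul_def, map_add, LinearMap.add_apply] at *; rw [ha, hb]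
  | hneg a ha => simp only [Gr.mul_def, map_neg, LinearMap.neg_apply] at *; rw [ha]
  | hof X =>
    induction y using Gr.induction with
    | h0 => simp [Gr.mul_def]
    | hadd a b ha hb => simp only [Gr.mul_def, map_add, LinearMap.add_apply] at *; rw [ha, hb]
    | hneg a ha => simp only [Gr.mul_def, map_neg, LinearMap.neg_apply] at *; rw [ha]
    | hof Y =>
      induction z using Gr.induction with
      | h0 => simp [Gr.mul_def]
      | hadd a b ha hb => simp only [Gr.mul_def, map_add] at *; rw [ha, hb]
      | hneg a ha => simp only [Gr.mul_def, map_neg] at *; rw [ha]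
      | hof Z =>
        rw [Gr.cls_mul_cls, Gr.cls_mul_cls, Gr.cls_mul_cls, Gr.cls_mul_cls]
        exact Gr.cls_of_iso (α_ X Y Z)

theorem Gr.one_mul' (x : Gr C) : 1 * x = x := by
  induction x using Gr.induction with
  | h0 => simp [Gr.mul_def]
  | hadd a b ha hb => simp only [Gr.mul_def, map_add] at *; rw [ha, hb]
  | hneg a ha => simp only [Gr.mul_def, map_neg] at *; rw [ha]
  | hof X => exact (Gr.cls_mul_cls (𝟙_ C) X).trans (Gr.cls_of_iso (λ_ X))

theorem Gr.mul_one' (x : Gr C) : x * 1 = x := by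
  induction x using Gr.induction with
  | h0 => simp [Gr.mul_def]
  | hadd a b ha hb => simp only [Gr.mul_def, map_add, LinearMap.add_apply] at *; rw [ha, hb]
  | hneg a ha => simp only [Gr.mul_def, map_neg, LinearMap.neg_apply] at *; rw [ha]
  | hof X => exact (Gr.cls_mul_cls X (𝟙_ C)).trans (Gr.cls_of_iso (ρ_ X))

/-- The Grothendieck ring. -/
noncomputable instance : Ring (Gr C) :=
  { (inferInstance : AddCommGroup (Gr C)), (inferInstance : Mul (Gr C)),
    (inferInstance : One (Gr C)) with
    left_distrib := fun x y z => map_add (Gr.mulMap x) y z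
    right_distrib := fun x y z => by simp [Gr.mul_def]
    zero_mul := fun x => by simp [Gr.mul_def]
    mul_zero := fun x => by simp [Gr.mul_def]
    mul_assoc := Gr.mul_assoc'
    one_mul := Gr.one_mul'
    mul_one := Gr.mul_one' }

end GrothendieckRing

section FiniteTensor

/-- A projective cover of `X`: a projective object `P` with an epimorphism `p : P ⟶ X` that is
essential, i.e. a morphism `f` to `P` is an epimorphism as soon as `f ≫ p` is one. -/
structure IsProjectiveCover {C : Type u} [Category.{v} C] {P X : C} (p : P ⟶ X) : Prop where
  projective : Projective P
  epi : Epi p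
  essential : ∀ {Q : C} (f : Q ⟶ P), Epi (f ≫ p) → Epi f

variable (C : Type u) [Category.{v} C] [Abelian C]

/-- A tensor category over `k`: a `k`-linear rigid abelian monoidal category with biadditive tensor
product, in which the neutral object is simple, the morphism spaces are finite dimensional and
all objects have finite length (the linear, rigid, abelian and monoidal structures are
parameters). -/
class TensorCategory (k : Type w) [Field k] [Linear k C] [MonoidalCategory C]
    [MonoidalPreadditive C] [RigidCategory C] : Prop where
  simple_unit : Simple (𝟙_ C)
  finiteDimensional_hom : ∀ X Y : C, FiniteDimensional k (X ⟶ Y)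
  finite_length : FiniteLengthCategory C

/-- A finite abelian category: finitely many isomorphism classes of simple objects, all objects
have finite length, and every simple object has a projective cover. -/
class FiniteAbelianCategory : Prop extends FiniteLengthCategory C where
  finite_simples : Finite (SimpleClass C)
  exists_projectiveCover : ∀ X : C, Simple X → ∃ (P : C) (p : P ⟶ X), IsProjectiveCover p

attribute [instance] FiniteAbelianCategory.finite_simples

variable {C} [FiniteAbelianCategory C] [MonoidalCategory C]

/-- The matrix `N_X` of left multiplication by `X`, with entries `[X ⊗ Xᵢ : Xⱼ]`. -/
noncomputable def fusionMatrix (X : C) : Matrix (SimpleClass C) (SimpleClass C) ℕ :=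
  fun i j => multiplicity (X ⊗ i.obj) j

open Classical in
/-- The Frobenius–Perron dimension of `X`: the spectral radius of the matrix `N_X`, i.e. the largest
absolute value of a complex eigenvalue. -/
noncomputable def fpDim (X : C) : ℝ :=
  letI : Fintype (SimpleClass C) := Fintype.ofFinite _
  (spectralRadius ℂ ((fusionMatrix X).map (Nat.cast : ℕ → ℂ))).toReal

end FiniteTensor

end FusionRing

/-!
Write `R` for the Grothendieck ring, with its basis of classes of simple objects, whose structure
constants are nonnegative. Rigidity enters once (`FusionRing.Gr.exists_repr_mul_pos`): for a simple
object `X`, the coevaluation `𝟙 ⟶ X ⊗ Xᘁ` is nonzero, hence a monomorphism since `𝟙` is simple, and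
tensoring with `Z` embeds `Z` into `X ⊗ (Xᘁ ⊗ Z)`. So each simple `Z` is a composition factor of
`X ⊗ Y` for some simple `Y`. In other words, right multiplication by the sum `β` of all basis
elements has a matrix with positive entries.

By Perron's theorem (`Matrix.exists_pos_eigenvector`, `Matrix.eq_smul_of_pos_eigenvector`) right
multiplication by `β` has a positive eigenvector `v` in `R ⊗ ℝ`, whose eigenspace is a line. Left
multiplications commute with right multiplication by `β`, so they preserve this line, and
`x * v = d(x) v` defines a ring homomorphism `d` to the real numbers
(`exists_pos_common_eigenvector`). Since `N_X` is the transpose of the matrix of left multiplication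
by `[X]`, the vector `v` is a positive left eigenvector of the nonnegative matrix `N_X`, so that its
eigenvalue `d([X])` is the spectral radius (`Matrix.spectralRadius_eq_of_pos_vecMul`). It is positive
for `X` simple, because `[X] * v` is then nonzero. Finally, the values of a character `χ` that is
positive on the basis form a positive eigenvector of every `N_X`, with eigenvalue `χ([X])`; pairing
it with `v` gives `χ = d` (`eq_of_pos_common_eigenvector`).
-/

/-! ### Positive matrices -/

section Perron

variable {ι : Type*} [Fintype ι]

theorem Matrix.mulVec_pos_of_pos {A : Matrix ι ι ℝ} (hA : ∀ i j, 0 < A i j) {z : ι → ℝ}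
    (hz : 0 ≤ z) (hz0 : z ≠ 0) (i : ι) : 0 < (A.mulVec z) i := by
  obtain ⟨j, hj⟩ := Function.ne_iff.1 hz0
  exact Finset.sum_pos' (fun k _ => mul_nonneg (hA i k).le (hz k))
    ⟨j, Finset.mem_univ j, mul_pos (hA i j) (lt_of_le_of_ne (hz j) (Ne.symm hj))⟩

/-- A sub-eigenvalue `r` of a nonnegative matrix (`r x ≤ A x` for some `x` in the standard simplex)
is at most the sum of the entries. -/
theorem Matrix.le_sum_of_smul_le_mulVec {A : Matrix ι ι ℝ} (hA : ∀ i j, 0 ≤ A i j) {x : ι → ℝ}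
    (hx : x ∈ stdSimplex ℝ ι) {r : ℝ} (h : r • x ≤ A.mulVec x) : r ≤ ∑ i, ∑ j, A i j := by
  calc r = ∑ i, (r • x) i := by simp [← Finset.mul_sum, hx.2]
    _ ≤ ∑ i, (A.mulVec x) i := Finset.sum_le_sum fun i _ => h i
    _ ≤ ∑ i, ∑ j, A i j := Finset.sum_le_sum fun i _ => Finset.sum_le_sum fun j _ =>
        mul_le_of_le_one_right (hA i j)
          (hx.2 ▸ Finset.single_le_sum (fun k _ => hx.1 k) (Finset.mem_univ j))

/-- Perron's theorem, existence: the largest `r` such that `r x ≤ A x` for some `x` in the standard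
simplex is an eigenvalue with positive eigenvector. -/
theorem Matrix.exists_pos_eigenvector [Nonempty ι] {A : Matrix ι ι ℝ} (hA : ∀ i j, 0 < A i j) :
    ∃ (r : ℝ) (v : ι → ℝ), (∀ i, 0 < v i) ∧ A.mulVec v = r • v := by
  classical
  have hbound := fun {x : ι → ℝ} (hx : x ∈ stdSimplex ℝ ι) {r : ℝ} =>
    Matrix.le_sum_of_smul_le_mulVec (r := r) (fun i j => (hA i j).le) hx
  let S : Set ((ι → ℝ) × ℝ) :=
    (stdSimplex ℝ ι ×ˢ Set.Icc 0 (∑ i, ∑ j, A i j)) ∩ {p | p.2 • p.1 ≤ A.mulVec p.1}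
  have hS : IsCompact S := ((isCompact_stdSimplex ℝ ι).prod isCompact_Icc).inter_right
    (isClosed_le (by fun_prop) (continuous_const.matrix_mulVec continuous_fst))
  have hne : S.Nonempty := by
    let i₀ : ι := Classical.arbitrary ι
    have hmem := single_mem_stdSimplex ℝ i₀
    refine ⟨(Pi.single i₀ 1, 0), ⟨hmem, le_rfl, ?_⟩, ?_⟩
    · exact Finset.sum_nonneg fun i _ => Finset.sum_nonneg fun j _ => (hA i j).le
    · intro i
      simpa using (hA i i₀).le
  obtain ⟨⟨x, r⟩, ⟨⟨hx, hr⟩, hle⟩, hmax⟩ := hS.exists_isMaxOn hne continuous_snd.continuousOn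
  change x ∈ stdSimplex ℝ ι at hx
  change r ∈ Set.Icc _ _ at hr
  change r • x ≤ A.mulVec x at hle
  have hx0 : x ≠ 0 := by
    rintro rfl
    simpa using hx.2
  have hy := Matrix.mulVec_pos_of_pos hA hx.1 hx0
  have heq : A.mulVec x = r • x := by
    by_contra hcon
    have hz := Matrix.mulVec_pos_of_pos hA (sub_nonneg.2 hle) (sub_ne_zero.2 hcon)
    -- The vector `y = A x` has `A y - r y = A (A x - r x) > 0`, so it allows a larger `r`.
    set y := A.mulVec x with hydef
    obtain ⟨i₁, hi₁⟩ := Finite.exists_min fun i => A.mulVec (y - r • x) i / y i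
    set ε := A.mulVec (y - r • x) i₁ / y i₁ with hε
    have hε0 : 0 < ε := div_pos (hz i₁) (hy i₁)
    have hs : 0 < ∑ i, y i := Finset.sum_pos (fun i _ => hy i) Finset.univ_nonempty
    have hmem : (∑ i, y i)⁻¹ • y ∈ stdSimplex ℝ ι := by
      refine ⟨fun i => mul_nonneg (inv_nonneg.2 hs.le) (hy i).le, ?_⟩
      simp only [Pi.smul_apply, smul_eq_mul, ← Finset.mul_sum]
      exact inv_mul_cancel₀ hs.ne'
    have hle' : (r + ε) • ((∑ i, y i)⁻¹ • y) ≤ A.mulVec ((∑ i, y i)⁻¹ • y) := by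
      rw [Matrix.mulVec_smul, smul_comm]
      refine smul_le_smul_of_nonneg_left (fun i => ?_) (inv_nonneg.2 hs.le)
      have h1 := (le_div_iff₀ (hy i)).1 (hi₁ i)
      rw [Matrix.mulVec_sub, Matrix.mulVec_smul, ← hydef] at h1
      simp only [Pi.sub_apply, Pi.smul_apply, smul_eq_mul] at h1 ⊢
      linarith
    have : r + ε ≤ r := hmax (a := ((∑ i, y i)⁻¹ • y, r + ε))
      ⟨⟨hmem, add_nonneg hr.1 hε0.le, hbound hmem hle'⟩, hle'⟩
    linarith
  refine ⟨r, A.mulVec x, hy, ?_⟩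
  rw [heq, Matrix.mulVec_smul, heq]

/-- Perron's theorem, uniqueness: the eigenspace of a positive eigenvector is a line. -/
theorem Matrix.eq_smul_of_pos_eigenvector [Nonempty ι] {A : Matrix ι ι ℝ} (hA : ∀ i j, 0 < A i j)
    {r : ℝ} {v w : ι → ℝ} (hv : ∀ i, 0 < v i) (hAv : A.mulVec v = r • v)
    (hAw : A.mulVec w = r • w) : ∃ c : ℝ, w = c • v := by
  -- Subtract from `w` the largest multiple of `v` that leaves a nonnegative vector.
  obtain ⟨i₀, hi₀⟩ := Finite.exists_min fun i => w i / v i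
  refine ⟨w i₀ / v i₀, ?_⟩
  by_contra hcon
  have hz : 0 ≤ w - (w i₀ / v i₀) • v := fun i => by
    simpa using (le_div_iff₀ (hv i)).1 (hi₀ i)
  have h := Matrix.mulVec_pos_of_pos hA hz (sub_ne_zero.2 hcon) i₀
  rw [Matrix.mulVec_sub, Matrix.mulVec_smul, hAv, hAw] at h
  simp only [Pi.sub_apply, Pi.smul_apply, smul_eq_mul] at h
  field_simp [(hv i₀).ne'] at h
  simp at h

/-- For a nonnegative matrix, the eigenvalue of a positive left eigenvector is the spectral
radius. -/
theorem Matrix.spectralRadius_eq_of_pos_vecMul [DecidableEq ι] [Nonempty ι] {M : Matrix ι ι ℝ}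
    (hM : ∀ i j, 0 ≤ M i j) {v : ι → ℝ} (hv : ∀ i, 0 < v i) {d : ℝ} (h : M.vecMul v = d • v) :
    (spectralRadius ℂ (M.map ((↑) : ℝ → ℂ))).toReal = d := by
  have hd : 0 ≤ d := by
    let i : ι := Classical.arbitrary ι
    have h1 : 0 ≤ (M.vecMul v) i := Finset.sum_nonneg fun j _ => mul_nonneg (hv j).le (hM j i)
    rw [h] at h1
    exact nonneg_of_mul_nonneg_left h1 (hv i)
  have hmem : (d : ℂ) ∈ spectrum ℂ (M.map ((↑) : ℝ → ℂ)) := by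
    rw [spectrum.mem_iff, Matrix.isUnit_iff_isUnit_det, isUnit_iff_ne_zero, not_not,
      ← Matrix.exists_vecMul_eq_zero_iff]
    refine ⟨fun i => (v i : ℂ), fun h0 => ?_, ?_⟩
    · have := congrFun h0 (Classical.arbitrary ι)
      simp only [Pi.zero_apply, Complex.ofReal_eq_zero] at this
      exact (hv _).ne' this
    · rw [Matrix.vecMul_sub, Algebra.algebraMap_eq_smul_one, Matrix.vecMul_smul, Matrix.vecMul_one,
        sub_eq_zero]
      ext i
      have := congrArg ((↑) : ℝ → ℂ) (congrFun h i)
      simpa [Matrix.vecMul, dotProduct] using this.symm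
  have hle : ∀ μ ∈ spectrum ℂ (M.map ((↑) : ℝ → ℂ)), ‖μ‖ ≤ d := by
    intro μ hμ
    rw [spectrum.mem_iff, Matrix.isUnit_iff_isUnit_det, isUnit_iff_ne_zero, not_not,
      ← Matrix.exists_mulVec_eq_zero_iff] at hμ
    obtain ⟨u, hu0, hu⟩ := hμ
    rw [Matrix.sub_mulVec, Algebra.algebraMap_eq_smul_one, Matrix.smul_mulVec, Matrix.one_mulVec,
      sub_eq_zero] at hu
    -- Pair `|μ| |u| ≤ M |u|` with the left eigenvector `v`.
    have h1 : ∀ i, ‖μ‖ * ‖u i‖ ≤ (M.mulVec fun j => ‖u j‖) i := fun i => by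
      rw [← norm_mul]
      have := congrFun hu i
      simp only [Pi.smul_apply, smul_eq_mul] at this
      rw [this]
      refine (norm_sum_le _ _).trans (Finset.sum_le_sum fun j _ => ?_)
      simp [abs_of_nonneg (hM i j)]
    obtain ⟨j, hj⟩ := Function.ne_iff.1 hu0
    have hpos : 0 < v ⬝ᵥ fun j => ‖u j‖ :=
      Finset.sum_pos' (fun k _ => mul_nonneg (hv k).le (norm_nonneg _))
        ⟨j, Finset.mem_univ j, mul_pos (hv j) (norm_pos_iff.2 hj)⟩
    refine le_of_mul_le_mul_right ?_ hpos
    calc ‖μ‖ * (v ⬝ᵥ fun j => ‖u j‖) = v ⬝ᵥ fun j => ‖μ‖ * ‖u j‖ :=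
          (dotProduct_smul ‖μ‖ v fun j => ‖u j‖).symm
      _ ≤ v ⬝ᵥ M.mulVec fun j => ‖u j‖ :=
          Finset.sum_le_sum fun i _ => mul_le_mul_of_nonneg_left (h1 i) (hv i).le
      _ = d * (v ⬝ᵥ fun j => ‖u j‖) := by
          rw [Matrix.dotProduct_mulVec, h, smul_dotProduct, smul_eq_mul]
  have : spectralRadius ℂ (M.map ((↑) : ℝ → ℂ)) = ENNReal.ofReal d := by
    refine le_antisymm (iSup₂_le fun μ hμ => ?_) ?_
    · rw [← enorm_eq_nnnorm, ← ofReal_norm]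
      exact ENNReal.ofReal_le_ofReal (hle μ hμ)
    · refine le_trans (le_of_eq ?_) (le_iSup₂ (f := fun (k : ℂ) _ => (‖k‖₊ : ENNReal)) (d : ℂ) hmem)
      rw [← enorm_eq_nnnorm, ← ofReal_norm, Complex.norm_of_nonneg hd]
  rw [this, ENNReal.toReal_ofReal hd]

end Perron

/-! ### Based rings -/

section BasedRing

variable {R ι : Type*} [Ring R] [Fintype ι] [DecidableEq ι]

/-- The real matrix of left multiplication by `x` in a `ℤ`-basis `b`; the column with index `j` holds
the coordinates of `x * b j`. -/
noncomputable def realLeftMul (b : Module.Basis ι ℤ R) : R →+* Matrix ι ι ℝ :=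
  (Int.castRingHom ℝ).mapMatrix.comp (Algebra.leftMulMatrix b).toRingHom

theorem realLeftMul_apply (b : Module.Basis ι ℤ R) (x : R) (i j : ι) :
    realLeftMul b x i j = (b.repr (x * b j) i : ℝ) := by
  simp [realLeftMul, Algebra.leftMulMatrix_eq_repr_mul]

/-- In a based ring with nonnegative structure constants in which, for each basis element `b i`, every
basis element occurs in some product `b i * b j`, there is a vector with positive coordinates that
is an eigenvector of all left multiplications: the Perron vector of right multiplication by the sum
of the basis. -/
theorem exists_pos_common_eigenvector [Nonempty ι] (b : Module.Basis ι ℤ R)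
    (hnn : ∀ i j l, 0 ≤ b.repr (b i * b j) l) (ht : ∀ i l, ∃ j, 0 < b.repr (b i * b j) l) :
    ∃ (v : ι → ℝ) (d : R →+* ℝ), (∀ i, 0 < v i) ∧
      ∀ x, (realLeftMul b x).mulVec v = d x • v := by
  let A : Matrix ι ι ℝ := (Int.castRingHom ℝ).mapMatrix
    (LinearMap.toMatrix b b (LinearMap.mulRight ℤ (∑ j, b j)))
  have hA : ∀ i j, 0 < A i j := fun i j => by
    have : A i j = ((b.repr (b j * ∑ l, b l) i : ℤ) : ℝ) := by
      simp [A, LinearMap.toMatrix_apply]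
    rw [this, Finset.mul_sum, map_sum, Finsupp.finsetSum_apply, Int.cast_pos]
    obtain ⟨l, hl⟩ := ht j i
    exact Finset.sum_pos' (fun k _ => hnn _ _ _) ⟨l, Finset.mem_univ l, hl⟩
  obtain ⟨r, v, hv, hAv⟩ := Matrix.exists_pos_eigenvector hA
  have hcomm : ∀ x, A * realLeftMul b x = realLeftMul b x * A := fun x => by
    change (Int.castRingHom ℝ).mapMatrix _ * (Int.castRingHom ℝ).mapMatrix _ =
      (Int.castRingHom ℝ).mapMatrix _ * (Int.castRingHom ℝ).mapMatrix _
    rw [← map_mul, ← map_mul]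
    change (Int.castRingHom ℝ).mapMatrix (_ * LinearMap.toMatrix b b (LinearMap.mulLeft ℤ x)) =
      (Int.castRingHom ℝ).mapMatrix (LinearMap.toMatrix b b (LinearMap.mulLeft ℤ x) * _)
    rw [← LinearMap.toMatrix_mul, ← LinearMap.toMatrix_mul,
      (LinearMap.commute_mulLeft_right x (∑ j, b j)).eq]
  have hex : ∀ x, ∃ c : ℝ, (realLeftMul b x).mulVec v = c • v := fun x => by
    refine Matrix.eq_smul_of_pos_eigenvector hA hv hAv ?_
    rw [Matrix.mulVec_mulVec, hcomm, ← Matrix.mulVec_mulVec, hAv, Matrix.mulVec_smul]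
  choose d hd using hex
  have hinj : ∀ {c c' : ℝ}, c • v = c' • v → c = c' := fun {c c'} h =>
    mul_right_cancel₀ (hv (Classical.arbitrary ι)).ne' (congrFun h (Classical.arbitrary ι))
  refine ⟨v, { toFun := d, map_one' := ?_, map_mul' := ?_, map_zero' := ?_, map_add' := ?_ }, hv, hd⟩
  · exact hinj (by rw [← hd, map_one, Matrix.one_mulVec, one_smul])
  · intro x y
    refine hinj ?_
    rw [← hd, map_mul, ← Matrix.mulVec_mulVec, hd, Matrix.mulVec_smul, hd, smul_smul, mul_comm]
  · exact hinj (by rw [← hd, map_zero, Matrix.zero_mulVec, zero_smul])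
  · intro x y
    exact hinj (by rw [← hd, map_add, Matrix.add_mulVec, hd, hd, add_smul])

/-- A character that is positive on the basis is a left eigenvector of all left multiplications, so
that it agrees with the eigenvalues of any positive common eigenvector. -/
theorem eq_of_pos_common_eigenvector [Nonempty ι] (b : Module.Basis ι ℤ R) {v : ι → ℝ}
    {d : R →+* ℝ} (hv : ∀ i, 0 < v i) (hd : ∀ x, (realLeftMul b x).mulVec v = d x • v)
    (χ : R →+* ℝ) (hχ : ∀ i, 0 < χ (b i)) : χ = d := by
  ext x
  have h1 : (realLeftMul b x).vecMul (fun i => χ (b i)) = χ x • fun i => χ (b i) := by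
    ext j
    simp only [Matrix.vecMul, dotProduct, realLeftMul_apply, Pi.smul_apply, smul_eq_mul]
    rw [← map_mul χ, ← congrArg χ (b.sum_repr (x * b j)), map_sum]
    exact Finset.sum_congr rfl fun i _ => by rw [zsmul_eq_mul, map_mul χ, map_intCast, mul_comm]
  have hpos : 0 < (fun i => χ (b i)) ⬝ᵥ v :=
    Finset.sum_pos (fun i _ => mul_pos (hχ i) (hv i)) Finset.univ_nonempty
  have h2 := Matrix.dotProduct_mulVec (fun i => χ (b i)) (realLeftMul b x) v
  rw [hd, h1, dotProduct_smul, smul_dotProduct] at h2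
  exact (mul_right_cancel₀ hpos.ne' h2).symm

/-- A common eigenvector of all left multiplications takes positive eigenvalues on the basis. -/
theorem pos_of_pos_common_eigenvector (b : Module.Basis ι ℤ R)
    (hnn : ∀ i j l, 0 ≤ b.repr (b i * b j) l) (ht : ∀ i l, ∃ j, 0 < b.repr (b i * b j) l)
    {v : ι → ℝ} {d : R →+* ℝ} (hv : ∀ i, 0 < v i)
    (hd : ∀ x, (realLeftMul b x).mulVec v = d x • v) (i : ι) : 0 < d (b i) := by
  have h : 0 < ((realLeftMul b (b i)).mulVec v) i := by
    obtain ⟨j, hj⟩ := ht i i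
    refine Finset.sum_pos' (fun k _ => mul_nonneg ?_ (hv k).le)
      ⟨j, Finset.mem_univ j, mul_pos ?_ (hv j)⟩
    · exact (Int.cast_nonneg (hnn i k i)).trans_eq (realLeftMul_apply b (b i) i k).symm
    · exact (Int.cast_pos.2 hj).trans_eq (realLeftMul_apply b (b i) i j).symm
  rw [hd] at h
  exact pos_of_mul_pos_left h (hv i).le

end BasedRing

/-! ### Transitivity of the Grothendieck ring -/

namespace FusionRing

universe v u

section Coevaluation

variable {C : Type u} [Category.{v} C] [Abelian C]
  [MonoidalCategory C] [MonoidalPreadditive C] [RigidCategory C]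

theorem coevaluation_ne_zero {X : C} (hX : ¬ IsZero X) : η_ X Xᘁ ≠ 0 := by
  intro h
  have h1 := ExactPairing.evaluation_coevaluation X Xᘁ
  rw [h, MonoidalPreadditive.zero_whiskerRight, zero_comp] at h1
  refine hX ((IsZero.iff_id_eq_zero X).2 ?_)
  have h2 := congrArg (fun f => (λ_ X).inv ≫ f ≫ (ρ_ X).hom) h1
  simpa using h2.symm

/-- The coevaluation makes `Z` a subobject of `X ⊗ (Xᘁ ⊗ Z)`. -/
theorem exists_mono_tensor [Simple (𝟙_ C)] {X : C} (hX : ¬ IsZero X) (Z : C) :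
    ∃ (W : C) (f : Z ⟶ X ⊗ W), Mono f := by
  have hη : Mono (η_ X Xᘁ) := mono_of_nonzero_from_simple (coevaluation_ne_zero hX)
  have hw : Mono (η_ X Xᘁ ▷ Z) := (tensorRight_shortExact Z _ _ (cokernel.condition (η_ X Xᘁ))
    (ShortComplex.ShortExact.mk' (ShortComplex.exact_cokernel _) inferInstance inferInstance)).mono_f
  exact ⟨Xᘁ ⊗ Z, (λ_ Z).inv ≫ η_ X Xᘁ ▷ Z ≫ (α_ X Xᘁ Z).hom, inferInstance⟩

end Coevaluation

section Transitivity

variable {C : Type u} [Category.{v} C] [Abelian C] [FiniteLengthCategory C]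

theorem multiplicity_le_of_mono {A X : C} (f : A ⟶ X) [Mono f] (s : SimpleClass C) :
    multiplicity A s ≤ multiplicity X s := by
  have h := Gr.cls_of_shortExact f (cokernel.π f) (cokernel.condition f)
    (ShortComplex.ShortExact.mk' (ShortComplex.exact_cokernel f) inferInstance inferInstance)
  have h1 := congrArg (fun x => (Gr.basis C).repr x s) h
  simp only [map_add, Finsupp.add_apply, Gr.basis_repr_cls] at h1
  omega

theorem multiplicity_obj_self (s : SimpleClass C) : multiplicity s.obj s = 1 := by
  have h := Gr.basis_repr_cls s.obj s
  rw [← Gr.of_eq_cls, ← Gr.basis_apply, Module.Basis.repr_self, Finsupp.single_eq_same] at h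
  exact_mod_cast h.symm

variable [MonoidalCategory C]

theorem Gr.repr_basis_mul_basis (s t r : SimpleClass C) :
    (Gr.basis C).repr (Gr.basis C s * Gr.basis C t) r = multiplicity (s.obj ⊗ t.obj) r := by
  rw [Gr.basis_apply, Gr.basis_apply, Gr.of_mul_of, Gr.basis_repr_cls]

variable [MonoidalPreadditive C] [RigidCategory C]

/-- For simple objects `s` and `r`, some simple object `t` has `r` as a composition factor of
`s ⊗ t`. -/
theorem Gr.exists_repr_mul_pos [Simple (𝟙_ C)] (s r : SimpleClass C) :
    ∃ t, 0 < (Gr.basis C).repr (Gr.basis C s * Gr.basis C t) r := by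
  obtain ⟨W, f, hf⟩ := exists_mono_tensor (Simple.not_isZero s.obj) r.obj
  have h1 := multiplicity_le_of_mono f r
  rw [multiplicity_obj_self] at h1
  by_contra! hcon
  have h0 : (Gr.basis C).repr (Gr.cls s.obj * Gr.cls W) r ≤ 0 := by
    rw [← Gr.of_eq_cls, ← Gr.basis_apply, Gr.cls]
    induction compositionFactors W using Multiset.induction with
    | empty => simp
    | cons a m ih =>
      rw [Multiset.map_cons, Multiset.sum_cons, mul_add, map_add, Finsupp.add_apply]
      exact add_nonpos (hcon a) ih
  rw [Gr.cls_mul_cls, Gr.basis_repr_cls] at h0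
  omega

end Transitivity

end FusionRing

theorem mainTheorem3 {k : Type*} [Field k] [IsAlgClosed k]
    {C : Type*} [Category* C] [Abelian C] [Linear k C] [MonoidalCategory C]
    [MonoidalPreadditive C] [RigidCategory C]
    [FusionRing.TensorCategory C k] [FusionRing.FiniteAbelianCategory C] :
    ∃ d : FusionRing.Gr C →+* ℝ,
      (∀ X : C, d (FusionRing.Gr.cls X) = FusionRing.fpDim X) ∧
      (∀ X : C, Simple X → 0 < FusionRing.fpDim X) ∧
      (∀ χ : FusionRing.Gr C →+* ℝ,
        (∀ s : FusionRing.SimpleClass C, 0 < χ (FusionRing.Gr.of s)) → χ = d) := by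
  classical
  let : Fintype (FusionRing.SimpleClass C) := Fintype.ofFinite _
  have hone : Simple (𝟙_ C) := FusionRing.TensorCategory.simple_unit k
  have : Nonempty (FusionRing.SimpleClass C) := ⟨FusionRing.simpleClass (𝟙_ C)⟩
  have hnn : ∀ i j l, 0 ≤ (FusionRing.Gr.basis C).repr
      (FusionRing.Gr.basis C i * FusionRing.Gr.basis C j) l := fun i j l => by
    rw [FusionRing.Gr.repr_basis_mul_basis]
    positivity
  have ht := FusionRing.Gr.exists_repr_mul_pos (C := C)
  obtain ⟨v, d, hv, hd⟩ := exists_pos_common_eigenvector (FusionRing.Gr.basis C) hnn ht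
  have hfp : ∀ X : C, d (FusionRing.Gr.cls X) = FusionRing.fpDim X := fun X => by
    -- The matrix `N_X` is the transpose of the matrix of left multiplication by `[X]`.
    have hN : (FusionRing.fusionMatrix X).map (Nat.cast : ℕ → ℝ) =
        (realLeftMul (FusionRing.Gr.basis C) (FusionRing.Gr.cls X)).transpose := by
      ext i j
      rw [Matrix.transpose_apply, realLeftMul_apply, FusionRing.Gr.basis_apply,
        FusionRing.Gr.of_eq_cls, FusionRing.Gr.cls_mul_cls, FusionRing.Gr.basis_repr_cls]
      simp [FusionRing.fusionMatrix]
    have h := Matrix.spectralRadius_eq_of_pos_vecMul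
      (M := (FusionRing.fusionMatrix X).map (Nat.cast : ℕ → ℝ)) (fun i j => by simp) hv
      (d := d (FusionRing.Gr.cls X)) (by rw [hN, Matrix.vecMul_transpose, hd])
    rw [← h, FusionRing.fpDim, Matrix.map_map]
    congr!
  refine ⟨d, hfp, fun X hX => ?_, fun χ hχ => ?_⟩
  · rw [← hfp, FusionRing.Gr.cls_simple]
    exact pos_of_pos_common_eigenvector _ hnn ht hv hd _
  · exact eq_of_pos_common_eigenvector _ hv hd χ hχ
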